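/- Let a geometric graph in $\mathbb{R}^d$ be a finite graph whose vertices are points of $\mathbb{R}^d$, each edge $uv$ ($u\neq v$) having weight $\|u-v\|_2$; its weight is the sum of its edge weights. For $t\ge 1$ and a finite set $S\subset\mathbb{R}^d$, a Euclidean Steiner $t$-spanner for $S$ is a geometric graph whose vertex set contains $S$ and in which any two points $p,q\in S$ are joined by a path of weight at most $t\|p-q\|_2$. Let $\mathrm{OPT}_t(S)$ denote the infimum of the weights of all Euclidean Steiner $t$-spanners for $S$. A (deterministic) online algorithm $\mathrm{ALG}$ that maintains a Euclidean Steiner $t$-spanner receives distinct points $s_1,s_2,\dots$ of $\mathbb{R}^d$ one by one. After the arrival of $s_i$ it must have a Euclidean Steiner $t$-spanner $G_i$ for $\{s_1,\dots,s_i\}$, where $G_i$ depends only on $(s_1,\dots,s_i)$ and arises from $G_{i-1}$ by finitely many operations of the following kinds: add a vertex, add an edge between two vertices, or subdivide an edge $uv$ at a point $w$ in its relative interior (that is, replace $uv$ by $uw$ and $wv$). Its competitive ratio on sequences of $n$ points is $$\rho_{\mathrm{ALG}}(n)=\sup_{(s_1,\dots,s_n)}\frac{\mathrm{weight}(G_n)}{\mathrm{OPT}_t(\{s_1,\dots,s_n\})}\in[0,\infty],$$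 the supremum being over all sequences of $n$ distinct points of $\mathbb{R}^d$. Theorem. For every $\varepsilon>0$ and every integer $d\ge 2$ there is a function $f:\mathbb{N}\to\mathbb{R}$ with $\lim_{n\to\infty}f(n)=\infty$ such that every online algorithm $\mathrm{ALG}$ that maintains a Euclidean Steiner $(1+\varepsilon)$-spanner in $\mathbb{R}^d$ satisfies $\rho_{\mathrm{ALG}}(n)=\Omega(f(n))$, with constants independent of $\mathrm{ALG}$: there are $c>0$ and $n_0\in\mathbb{N}$, depending only on $\varepsilon$ and $d$, such that $\rho_{\mathrm{ALG}}(n)\ge c\,f(n)$ for all $n\ge n_0$ and all such $\mathrm{ALG}$. -/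

import Mathlib

open scoped ENNReal
open Filter

noncomputable section

namespace OnlineSpanner

/-- Points of Euclidean `d`-space (with the `L₂` norm). -/
abbrev Point (d : ℕ) : Type := EuclideanSpace ℝ (Fin d)

/-- A finite geometric graph: finitely many points of `ℝ^d` as vertices, and finitely many edges,
each an unordered pair of distinct vertices (to be thought of as a straight-line segment). -/
structure GeomGraph (d : ℕ) where
  verts : Finset (Point d)
  edges : Finset (Sym2 (Point d))
  not_isDiag : ∀ e ∈ edges, ¬ e.IsDiag
  mem_verts : ∀ e ∈ edges, ∀ v ∈ e, v ∈ verts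

/-- The weight of an edge: the Euclidean distance of its endpoints. -/
def edgeWeight {d : ℕ} (e : Sym2 (Point d)) : ℝ :=
  Sym2.lift ⟨fun u v => dist u v, fun u v => dist_comm u v⟩ e

namespace GeomGraph

variable {d : ℕ}

/-- The weight of a graph is the sum of its edge weights. -/
def weight (G : GeomGraph d) : ℝ := ∑ e ∈ G.edges, edgeWeight e

/-- The adjacency structure of `G`, used to speak about walks in `G`. -/
def graph (G : GeomGraph d) : SimpleGraph (Point d) :=
  SimpleGraph.fromEdgeSet (G.edges : Set (Sym2 (Point d)))

/-- The weight of a walk: the sum of the weights of the edges traversed. -/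
def walkWeight (G : GeomGraph d) {u v : Point d} (p : G.graph.Walk u v) : ℝ :=
  (p.edges.map edgeWeight).sum

/-- `G` is a Euclidean Steiner `t`-spanner for `S`: every point of `S` is a vertex, and any two
points of `S` are joined in `G` by a walk of weight at most `t` times their distance. Vertices of
`G` outside `S` are Steiner points; no stretch is required for them. -/
def IsSteinerSpanner (G : GeomGraph d) (t : ℝ) (S : Set (Point d)) : Prop :=
  (∀ u ∈ S, u ∈ G.verts) ∧
    ∀ u ∈ S, ∀ v ∈ S, ∃ p : G.graph.Walk u v, G.walkWeight p ≤ t * dist u v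

/-- The elementary modifications that an online algorithm may make: add a vertex, add an edge
between two vertices, or subdivide an edge by a point in its relative interior. -/
inductive Step (G H : GeomGraph d) : Prop
  | addVertex (w : Point d)
      (hv : (H.verts : Set (Point d)) = insert w (G.verts : Set (Point d)))
      (he : H.edges = G.edges)
  | addEdge (u v : Point d)
      (hv : H.verts = G.verts)
      (he : (H.edges : Set (Sym2 (Point d))) = insert s(u, v) (G.edges : Set (Sym2 (Point d))))
  | subdivide (u v w : Point d)
      (huv : s(u, v) ∈ G.edges)
      (hw : w ∈ openSegment ℝ u v)
      (hv : (H.verts : Set (Point d)) = insert w (G.verts : Set (Point d)))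
      (he : (H.edges : Set (Sym2 (Point d))) =
        ((G.edges : Set (Sym2 (Point d))) \ {s(u, v)}) ∪ {s(u, w), s(w, v)})

/-- `H` arises from `G` by finitely many elementary modifications. -/
def Augments (G H : GeomGraph d) : Prop := Relation.ReflTransGen Step G H

end GeomGraph

/-- A (deterministic) online algorithm maintaining a Euclidean Steiner `t`-spanner in `ℝ^d`.
`output [s₁, …, s_i]` is the graph `G_i` after the (distinct) points `s₁, …, s_i` have been
presented in this order; it depends on these points only, it is a Steiner `t`-spanner for them,
and upon the arrival of a new point the current graph may only be augmented. -/
structure OnlineAlgorithm (d : ℕ) (t : ℝ) where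
  output : List (Point d) → GeomGraph d
  isSteinerSpanner : ∀ σ : List (Point d), σ.Nodup →
    (output σ).IsSteinerSpanner t {s | s ∈ σ}
  augments : ∀ (σ : List (Point d)) (s : Point d), (σ ++ [s]).Nodup →
    (output σ).Augments (output (σ ++ [s]))

/-- `OPT`: the minimum weight of a Euclidean Steiner `t`-spanner for `S`. -/
def opt {d : ℕ} (t : ℝ) (S : Set (Point d)) : ℝ≥0∞ :=
  ⨅ (G : GeomGraph d) (_ : G.IsSteinerSpanner t S), ENNReal.ofReal G.weight

/-- The competitive ratio on sequences of `n` points: the supremum of `ALG(σ) / OPT(σ)` over all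
sequences `σ` of `n` distinct points (`OPT(σ)` is positive when `n ≥ 2`). -/
def OnlineAlgorithm.competitiveRatio {d : ℕ} {t : ℝ} (A : OnlineAlgorithm d t) (n : ℕ) : ℝ≥0∞ :=
  ⨆ (σ : List (Point d)) (_ : σ.Nodup ∧ σ.length = n),
    ENNReal.ofReal (A.output σ).weight / opt t {s | s ∈ σ}

end OnlineSpanner

end

/-! The adversary works in a plane, on nearly parallel copies of a unit segment. Row `l` consists of
`B ^ l + 1` equally spaced points on a horizontal unit segment, and the vertical gap from row `l` to
row `l + 1` lies between `R / B ^ (l + 1)` and `2 * R / B ^ (l + 1)`: tiny compared with the spacing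
of row `l`, large compared with that of row `l + 1`.

Online cost: connectivity alone forces length at least `1 / 2` into the strip around a row whose
half-width is half the spacing, because a connected graph must leave the disjoint balls around the
row's points. There are `R` disjoint strips to choose from for the next row. If the current graph
has length at most `R / 4`, one strip holds at most `1 / 4` of it, and a row placed there costs
another `1 / 4`. So `R` steps force length `R / 4` (`exists_rows_le_hausdorffMeasure`). Length is
the one-dimensional Hausdorff measure of the union of the edges, which grows under every allowed
operation and is at most the weight.

Offline cost: knowing the last row, one draws only its segment, of length 1, and joins each earlier
point to it by a fan of short edges. Row `i` has about `B ^ i` points with edges of length `O(1 / B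
^ (i + 1))`, so for large `B` all fans together cost at most 1. Fans replace steep connections by
nearly straight paths, which keeps the stretch below `1 + ε` (`reach_of_fan`,
`exists_isSteinerSpanner_weight_le_two`).

Thus the ratio is at least `R / 8`, with `R` arbitrary. Extra points on the last segment realise
every larger number of points without raising the offline bound. -/

namespace OnlineSpanner

open MeasureTheory Measure Set

/-! ### Length of the covered set as a monotone substitute for weight. -/

namespace GeomGraph

variable {d : ℕ}

/-- The set of points covered by the edges of `G`, regarded as segments. -/
def carrier (G : GeomGraph d) : Set (Point d) :=
  {x | ∃ u v, s(u, v) ∈ G.edges ∧ x ∈ segment ℝ u v}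

/-- Subdivision removes an edge, so edge sets are not monotone; the two halves still cover the old
segment. -/
theorem Step.carrier_subset {G H : GeomGraph d} (h : Step G H) : G.carrier ⊆ H.carrier := by
  rintro x ⟨a, b, hab, hx⟩
  cases h with
  | addVertex w hv he => exact ⟨a, b, he ▸ hab, hx⟩
  | addEdge u v hv he =>
    refine ⟨a, b, ?_, hx⟩
    have : s(a, b) ∈ (H.edges : Set (Sym2 (Point d))) := by
      rw [he]; exact Or.inr hab
    exact this
  | subdivide u v w huv hw hv he =>
    have hmem : ∀ e, e ∈ H.edges ↔ e ∈ (H.edges : Set (Sym2 (Point d))) := fun _ => Iff.rfl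
    by_cases hs : s(a, b) = s(u, v)
    · have hx' : x ∈ segment ℝ u v := by
        rcases Sym2.eq_iff.1 hs with ⟨rfl, rfl⟩ | ⟨rfl, rfl⟩
        · exact hx
        · rwa [segment_symm]
      have huw : s(u, w) ∈ H.edges := by rw [hmem, he]; simp
      have hwv : s(w, v) ∈ H.edges := by rw [hmem, he]; simp
      rw [← insert_endpoints_openSegment] at hx'
      rcases hx' with rfl | rfl | hx'
      · exact ⟨_, _, huw, left_mem_segment _ _ _⟩
      · exact ⟨_, _, hwv, right_mem_segment _ _ _⟩
      · have hw' : w ∈ range (AffineMap.lineMap u v : ℝ → Point d) := by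
          rw [openSegment_eq_image_lineMap] at hw
          exact image_subset_range _ _ hw
        rcases openSegment_subset_union u v hw' hx' with rfl | hx' | hx'
        · exact ⟨_, _, huw, right_mem_segment _ _ _⟩
        · exact ⟨_, _, huw, openSegment_subset_segment _ _ _ hx'⟩
        · exact ⟨_, _, hwv, openSegment_subset_segment _ _ _ hx'⟩
    · refine ⟨a, b, ?_, hx⟩
      rw [hmem, he]
      exact Or.inl ⟨hab, hs⟩

theorem Augments.carrier_subset {G H : GeomGraph d} (h : Augments G H) :
    G.carrier ⊆ H.carrier := by
  induction h with
  | refl => exact Subset.rfl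
  | tail _ h ih => exact ih.trans h.carrier_subset

theorem edgeWeight_nonneg (e : Sym2 (Point d)) : 0 ≤ edgeWeight e := by
  induction e with
  | h u v => exact dist_nonneg (x := u) (y := v)

/-- Overlapping edges are counted once on the left, hence only an inequality, in the direction that
a lower bound on weight needs. -/
theorem hausdorffMeasure_carrier_le (G : GeomGraph d) :
    μH[1] G.carrier ≤ ENNReal.ofReal G.weight := by
  let seg : Sym2 (Point d) → Set (Point d) :=
    fun e => {x | ∃ u v, e = s(u, v) ∧ x ∈ segment ℝ u v}
  have hseg : ∀ u v, seg s(u, v) = segment ℝ u v := by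
    intro u v
    ext x
    constructor
    · rintro ⟨a, b, h, hx⟩
      rcases Sym2.eq_iff.1 h with ⟨rfl, rfl⟩ | ⟨rfl, rfl⟩
      · exact hx
      · rwa [segment_symm]
    · exact fun hx => ⟨u, v, rfl, hx⟩
  have hsub : G.carrier ⊆ ⋃ e ∈ G.edges, seg e := by
    rintro x ⟨u, v, h, hx⟩
    exact mem_biUnion h ⟨u, v, rfl, hx⟩
  calc μH[1] G.carrier ≤ μH[1] (⋃ e ∈ G.edges, seg e) := measure_mono hsub
    _ ≤ ∑ e ∈ G.edges, μH[1] (seg e) := measure_biUnion_finset_le _ _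
    _ = ∑ e ∈ G.edges, ENNReal.ofReal (edgeWeight e) := by
        refine Finset.sum_congr rfl fun e _ => ?_
        induction e with
        | h u v => rw [hseg, hausdorffMeasure_segment, edist_dist]; rfl
    _ = ENNReal.ofReal G.weight :=
        (ENNReal.ofReal_sum_of_nonneg fun e _ => edgeWeight_nonneg e).symm

/-- The intermediate value theorem applies on the first edge whose far end has reached level `t`. -/
theorem exists_mem_carrier_of_walk {G : GeomGraph d} {f : Point d → ℝ} (hf : Continuous f)
    {t : ℝ} {u v : Point d} (p : G.graph.Walk u v) (hu : f u ≤ t) (hv : t < f v) :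
    ∃ x ∈ G.carrier, f x = t := by
  induction p with
  | nil => exact absurd hv (not_lt.2 hu)
  | @cons u w v h p ih =>
    by_cases hw : f w < t
    · exact ih hw.le hv
    · have he : s(u, w) ∈ G.edges := by
        have := (SimpleGraph.fromEdgeSet_adj _).1 h
        exact this.1
      obtain ⟨x, hx, hxt⟩ := (convex_segment (𝕜 := ℝ) u w).isPreconnected.intermediate_value
        (left_mem_segment ℝ u w) (right_mem_segment ℝ u w) hf.continuousOn
        ⟨hu, not_lt.1 hw⟩
      exact ⟨x, ⟨u, w, he, hx⟩, hxt⟩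

/-- A connected graph that leaves a ball has length at least the radius inside it. -/
theorem ofReal_le_hausdorffMeasure_ball_inter {G : GeomGraph d} {p q : Point d}
    (w : G.graph.Walk p q) {r : ℝ} (hr : r ≤ dist q p) :
    ENNReal.ofReal r ≤ μH[1] (Metric.ball p r ∩ G.carrier) := by
  have hL : LipschitzWith 1 (fun x : Point d => dist x p) := LipschitzWith.dist_left p
  have h := hL.hausdorffMeasure_image_le zero_le_one (Metric.ball p r ∩ G.carrier)
  rw [hausdorffMeasure_real] at h
  simp only [ENNReal.coe_one, ENNReal.one_rpow, one_mul] at h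
  refine le_trans ?_ h
  -- The distance to `p` is 1-Lipschitz and takes all values in `[0, r)` along the walk.
  have hsub : Ico 0 r ⊆ (fun x : Point d => dist x p) '' (Metric.ball p r ∩ G.carrier) := by
    rintro t ⟨h0, h1⟩
    obtain ⟨x, hx, rfl⟩ := exists_mem_carrier_of_walk hL.continuous w (t := t)
      (by simpa using h0) (h1.trans_le hr)
    exact ⟨x, ⟨h1, hx⟩, rfl⟩
  calc ENNReal.ofReal r = volume (Ico (0 : ℝ) r) := by simp
    _ ≤ _ := measure_mono hsub

end GeomGraph

theorem OnlineAlgorithm.carrier_subset_append {d : ℕ} {t : ℝ} (A : OnlineAlgorithm d t)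
    (σ τ : List (Point d)) (h : (σ ++ τ).Nodup) :
    (A.output σ).carrier ⊆ (A.output (σ ++ τ)).carrier := by
  induction τ using List.reverseRecOn with
  | nil => simp
  | append_singleton τ s ih =>
    rw [← List.append_assoc] at h ⊢
    exact (ih h.of_append_left).trans (A.augments _ _ h).carrier_subset

end OnlineSpanner

/-! ### Rows of points and the length forced into their strips. -/

namespace OnlineSpanner

open MeasureTheory Measure Set

/-- The point `(x, y, 0, …, 0)`. -/
noncomputable def planePoint {d : ℕ} (x y : ℝ) : Point d :=
  WithLp.toLp 2 fun k => if (k : ℕ) = 0 then x else if (k : ℕ) = 1 then y else 0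

theorem dist_planePoint {d : ℕ} (hd : 2 ≤ d) (x y x' y' : ℝ) :
    dist (planePoint x y : Point d) (planePoint x' y') = √((x - x') ^ 2 + (y - y') ^ 2) := by
  obtain ⟨k, rfl⟩ := Nat.exists_eq_add_of_le' hd
  rw [EuclideanSpace.dist_eq]
  congr 1
  rw [Fin.sum_univ_succ, Fin.sum_univ_succ]
  simp [planePoint, Real.dist_eq, sq_abs]

theorem abs_sub_fst_le_dist {d : ℕ} (hd : 2 ≤ d) (x y x' y' : ℝ) :
    |x - x'| ≤ dist (planePoint x y : Point d) (planePoint x' y') := by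
  rw [dist_planePoint hd]
  exact Real.abs_le_sqrt (by nlinarith [sq_nonneg (y - y')])

theorem abs_sub_snd_le_dist {d : ℕ} (hd : 2 ≤ d) (x y x' y' : ℝ) :
    |y - y'| ≤ dist (planePoint x y : Point d) (planePoint x' y') := by
  rw [dist_planePoint hd]
  exact Real.abs_le_sqrt (by nlinarith [sq_nonneg (x - x')])

theorem dist_planePoint_horizontal {d : ℕ} (hd : 2 ≤ d) (x x' y : ℝ) :
    dist (planePoint x y : Point d) (planePoint x' y) = |x - x'| := by
  simp [dist_planePoint hd, Real.sqrt_sq_eq_abs]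

theorem dist_planePoint_vertical {d : ℕ} (hd : 2 ≤ d) (x y y' : ℝ) :
    dist (planePoint x y : Point d) (planePoint x y') = |y - y'| := by
  simp [dist_planePoint hd, Real.sqrt_sq_eq_abs]

theorem dist_planePoint_le {d : ℕ} (hd : 2 ≤ d) (x y x' y' : ℝ) :
    dist (planePoint x y : Point d) (planePoint x' y') ≤ |x - x'| + |y - y'| := by
  calc _ ≤ _ := dist_triangle _ (planePoint x' y) _
    _ = _ := by rw [dist_planePoint_horizontal hd, dist_planePoint_vertical hd]

theorem planePoint_injective {d : ℕ} (hd : 2 ≤ d) {x y x' y' : ℝ}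
    (h : (planePoint x y : Point d) = planePoint x' y') : x = x' ∧ y = y' := by
  have h1 := abs_sub_fst_le_dist hd x y x' y'
  have h2 := abs_sub_snd_le_dist hd x y x' y'
  rw [h, dist_self] at h1 h2
  exact ⟨sub_eq_zero.1 (abs_nonpos_iff.1 h1), sub_eq_zero.1 (abs_nonpos_iff.1 h2)⟩

/-- The points `(j / N, y)` for `0 ≤ j ≤ N`. -/
noncomputable def row {d : ℕ} (N : ℕ) (y : ℝ) : List (Point d) :=
  (List.range (N + 1)).map fun j : ℕ => planePoint ((j : ℝ) / N) y

theorem mem_row {d : ℕ} {N : ℕ} {y : ℝ} {p : Point d} :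
    p ∈ row N y ↔ ∃ j : ℕ, j ≤ N ∧ planePoint ((j : ℝ) / N) y = p := by
  simp [row]

@[simp]
theorem length_row {d : ℕ} (N : ℕ) (y : ℝ) : (row N y : List (Point d)).length = N + 1 := by
  simp [row]

theorem nodup_row {d : ℕ} (hd : 2 ≤ d) {N : ℕ} (hN : 0 < N) (y : ℝ) :
    (row N y : List (Point d)).Nodup := by
  refine List.Nodup.map (fun j k h => ?_) List.nodup_range
  have h1 := (planePoint_injective hd h).1
  have hN' : (N : ℝ) ≠ 0 := by positivity
  exact_mod_cast (div_left_inj' hN').1 h1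

/-- The open horizontal strip of half-width `δ` around height `y`. -/
def strip {d : ℕ} (hd : 2 ≤ d) (y δ : ℝ) : Set (Point d) := {v | |v ⟨1, hd⟩ - y| < δ}

theorem measurableSet_strip {d : ℕ} (hd : 2 ≤ d) (y δ : ℝ) : MeasurableSet (strip hd y δ) := by
  have : IsOpen (strip hd y δ) := by
    unfold strip
    exact isOpen_lt (by fun_prop) continuous_const
  exact this.measurableSet

theorem ball_subset_strip {d : ℕ} (hd : 2 ≤ d) (x y δ : ℝ) :
    Metric.ball (planePoint x y : Point d) δ ⊆ strip hd y δ := by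
  intro v hv
  rw [mem_ball_iff_norm] at hv
  have h := PiLp.norm_apply_le (v - planePoint x y) (⟨1, hd⟩ : Fin d)
  have h1 : (v - planePoint x y : Point d) ⟨1, hd⟩ = v ⟨1, hd⟩ - y := by simp [planePoint]
  rw [h1, Real.norm_eq_abs] at h
  exact h.trans_lt hv

theorem disjoint_strip {d : ℕ} (hd : 2 ≤ d) {y y' δ : ℝ} (h : 2 * δ ≤ |y - y'|) :
    Disjoint (strip hd y δ) (strip hd y' δ) := by
  rw [Set.disjoint_left]
  intro v h1 h2
  have h1' : |v ⟨1, hd⟩ - y| < δ := h1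
  have h2' : |v ⟨1, hd⟩ - y'| < δ := h2
  have := abs_sub_le y (v ⟨1, hd⟩) y'
  rw [abs_sub_comm y (v _)] at this
  linarith

/-- Inside the strip around a row, a spanner of the row has length at least `1 / 2`. -/
theorem half_le_hausdorffMeasure_strip_inter {d : ℕ} (hd : 2 ≤ d) {G : GeomGraph d} {t : ℝ}
    {S : Set (Point d)} (hG : G.IsSteinerSpanner t S) {N : ℕ} (hN : 0 < N) {y : ℝ}
    (hS : ∀ p ∈ (row N y : List (Point d)), p ∈ S) :
    ENNReal.ofReal (1 / 2) ≤ μH[1] (strip hd y (1 / (2 * N)) ∩ G.carrier) := by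
  have hN' : (0 : ℝ) < N := by exact_mod_cast hN
  let c : ℕ → Point d := fun j => planePoint ((j : ℝ) / N) y
  have hsep : ∀ j k : ℕ, j ≠ k → 2 * (1 / (2 * (N : ℝ))) ≤ dist (c j) (c k) := by
    intro j k hjk
    rw [dist_planePoint_horizontal hd, ← sub_div, abs_div, abs_of_pos hN',
      show 2 * (1 / (2 * (N : ℝ))) = 1 / N by field_simp]
    gcongr
    have : (1 : ℤ) ≤ |(j : ℤ) - k| := Int.one_le_abs (by omega)
    exact_mod_cast this
  have hmem : ∀ j ≤ N, c j ∈ S := fun j hj => hS _ (mem_row.2 ⟨j, hj, rfl⟩)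
  have hball : ∀ j ∈ Finset.range (N + 1), ENNReal.ofReal (1 / (2 * N)) ≤
      (μH[1].restrict G.carrier) (Metric.ball (c j) (1 / (2 * N))) := by
    intro j hj
    rw [Measure.restrict_apply Metric.isOpen_ball.measurableSet]
    -- Any other point of the row lies outside the ball, so a walk to it must leave the ball.
    obtain ⟨k, hk, hjk⟩ : ∃ k ≤ N, k ≠ j := by
      by_cases h0 : j = 0
      · exact ⟨1, hN, by omega⟩
      · exact ⟨0, hN.le, by omega⟩
    obtain ⟨w, -⟩ := hG.2 (c j) (hmem j (by simpa [Nat.lt_succ_iff] using hj)) (c k) (hmem k hk)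
    refine GeomGraph.ofReal_le_hausdorffMeasure_ball_inter w ?_
    have := hsep k j hjk
    have : 0 < 1 / (2 * (N : ℝ)) := by positivity
    linarith
  rw [← Measure.restrict_apply (measurableSet_strip hd y _)]
  calc ENNReal.ofReal (1 / 2)
      ≤ ∑ _j ∈ Finset.range (N + 1), ENNReal.ofReal (1 / (2 * N)) := by
        rw [← ENNReal.ofReal_sum_of_nonneg (fun _ _ => by positivity)]
        apply ENNReal.ofReal_le_ofReal
        rw [Finset.sum_const, Finset.card_range, nsmul_eq_mul]
        push_cast
        rw [mul_one_div, div_le_div_iff₀ (by norm_num) (by positivity)]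
        linarith
    _ ≤ ∑ j ∈ Finset.range (N + 1),
        (μH[1].restrict G.carrier) (Metric.ball (c j) (1 / (2 * N))) := Finset.sum_le_sum hball
    _ = (μH[1].restrict G.carrier)
        (⋃ j ∈ Finset.range (N + 1), Metric.ball (c j) (1 / (2 * N))) := by
        rw [measure_biUnion_finset]
        · intro j _ k _ hjk
          exact Metric.ball_disjoint_ball (by have := hsep j k hjk; linarith)
        · exact fun _ _ => Metric.isOpen_ball.measurableSet
    _ ≤ _ := measure_mono (iUnion₂_subset fun j _ => ball_subset_strip hd _ _ _)

/-- Among `R` disjoint strips, one contains at most a fraction `1 / R` of a set. -/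
theorem exists_hausdorffMeasure_strip_inter_le {d : ℕ} (hd : 2 ≤ d) {K : Set (Point d)} {R : ℕ}
    (hR : 0 < R) (hK : μH[1] K ≤ ENNReal.ofReal (R / 4)) (y : ℝ) {δ : ℝ} (hδ : 0 ≤ δ) :
    ∃ r : ℕ, R ≤ r ∧ r ≤ 2 * R ∧
      μH[1] (strip hd (y + r * (2 * δ)) δ ∩ K) ≤ ENNReal.ofReal (1 / 4) := by
  let s := Finset.Ico R (2 * R)
  have hs : s.Nonempty := Finset.nonempty_Ico.2 (by omega)
  have hsum : ∑ r ∈ s, (μH[1].restrict K) (strip hd (y + r * (2 * δ)) δ) ≤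
      ∑ _r ∈ s, ENNReal.ofReal (1 / 4) := by
    -- Neighbouring centres are `2 * δ` apart, so the open strips are disjoint and averaging over
    -- the `R` of them applies.
    calc _ ≤ (μH[1].restrict K) univ := by
          refine sum_measure_le_measure_univ
            (fun r _ => (measurableSet_strip hd _ _).nullMeasurableSet) fun j _ k _ hjk => ?_
          refine (disjoint_strip hd ?_).aedisjoint
          have h1 : (1 : ℤ) ≤ |(j : ℤ) - k| := Int.one_le_abs (by omega)
          have h2 : (1 : ℝ) ≤ |(j : ℝ) - k| := by exact_mod_cast h1
          rw [show y + (j : ℝ) * (2 * δ) - (y + k * (2 * δ)) = (j - k) * (2 * δ) by ring, abs_mul,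
            abs_of_nonneg (by positivity : 0 ≤ 2 * δ)]
          nlinarith
      _ ≤ ENNReal.ofReal (R / 4) := by simpa using hK
      _ = _ := by
          rw [← ENNReal.ofReal_sum_of_nonneg (fun _ _ => by norm_num), Finset.sum_const,
            Nat.card_Ico, nsmul_eq_mul, two_mul, Nat.add_sub_cancel]
          congr 1
          ring
  obtain ⟨r, hr, h⟩ := ENNReal.exists_le_of_sum_le hs hsum
  rw [Finset.mem_Ico] at hr
  rw [Measure.restrict_apply (measurableSet_strip hd _ _)] at h
  exact ⟨r, hr.1, hr.2.le, h⟩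

/-- If a strip contains little of the current graph, then presenting a row in its middle increases
the length of the graph by at least `1 / 4`. -/
theorem OnlineAlgorithm.hausdorffMeasure_carrier_append_row {d : ℕ} (hd : 2 ≤ d) {t : ℝ}
    (A : OnlineAlgorithm d t) {σ : List (Point d)} {N : ℕ} (hN : 0 < N) {y : ℝ}
    (hσ : (σ ++ row N y).Nodup)
    (h : μH[1] (strip hd y (1 / (2 * N)) ∩ (A.output σ).carrier) ≤ ENNReal.ofReal (1 / 4)) :
    μH[1] (A.output σ).carrier + ENNReal.ofReal (1 / 4) ≤
      μH[1] (A.output (σ ++ row N y)).carrier := by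
  set K := (A.output σ).carrier
  set K' := (A.output (σ ++ row N y)).carrier
  set T := strip hd y (1 / (2 * N))
  have hT : MeasurableSet T := measurableSet_strip hd _ _
  have hKK : K ⊆ K' := A.carrier_subset_append _ _ hσ
  have h1 : ENNReal.ofReal (1 / 2) ≤ μH[1] (T ∩ K') :=
    half_le_hausdorffMeasure_strip_inter hd (A.isSteinerSpanner _ hσ) hN
      fun p hp => List.mem_append_right _ hp
  -- Outside the strip the length cannot drop; inside it rises from at most `1 / 4` to at least `1 /
  -- 2`.
  rw [← measure_inter_add_sdiff K' hT, ← measure_inter_add_sdiff K hT, inter_comm K, inter_comm K']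
  calc μH[1] (T ∩ K) + μH[1] (K \ T) + ENNReal.ofReal (1 / 4)
      ≤ ENNReal.ofReal (1 / 4) + μH[1] (K' \ T) + ENNReal.ofReal (1 / 4) := by gcongr
    _ = ENNReal.ofReal (1 / 2) + μH[1] (K' \ T) := by
        rw [add_right_comm, ← ENNReal.ofReal_add (by norm_num) (by norm_num)]
        norm_num
    _ ≤ _ := by gcongr

end OnlineSpanner

/-! ### The adaptive adversary. -/

namespace OnlineSpanner

open MeasureTheory Measure Set

/-- The concatenation of the rows with `B ^ l + 1` points at height `a l`, for `l ≤ i`. -/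
noncomputable def rows {d : ℕ} (B : ℕ) (a : ℕ → ℝ) : ℕ → List (Point d)
  | 0 => row (B ^ 0) (a 0)
  | i + 1 => rows B a i ++ row (B ^ (i + 1)) (a (i + 1))

theorem rows_congr {d : ℕ} (B : ℕ) {a a' : ℕ → ℝ} {i : ℕ} (h : ∀ l ≤ i, a l = a' l) :
    (rows B a i : List (Point d)) = rows B a' i := by
  induction i with
  | zero => simp [rows, h 0 le_rfl]
  | succ i ih => rw [rows, rows, ih fun l hl => h l (hl.trans i.le_succ), h _ le_rfl]

theorem mem_rows {d : ℕ} {B : ℕ} {a : ℕ → ℝ} {i : ℕ} {p : Point d} :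
    p ∈ rows B a i ↔ ∃ l ≤ i, p ∈ row (B ^ l) (a l) := by
  induction i with
  | zero => simp [rows]
  | succ i ih =>
    rw [rows, List.mem_append, ih]
    constructor
    · rintro (⟨l, hl, h⟩ | h)
      · exact ⟨l, hl.trans i.le_succ, h⟩
      · exact ⟨_, le_rfl, h⟩
    · rintro ⟨l, hl, h⟩
      rcases Nat.le_succ_iff.1 hl with hl | rfl
      · exact Or.inl ⟨l, hl, h⟩
      · exact Or.inr h

theorem length_rows {d : ℕ} (B : ℕ) (a : ℕ → ℝ) (i : ℕ) :
    (rows B a i : List (Point d)).length = ∑ l ∈ Finset.range (i + 1), (B ^ l + 1) := by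
  induction i with
  | zero => simp [rows]
  | succ i ih => rw [rows, List.length_append, ih, length_row, ← Finset.sum_range_succ]

/-- Consecutive heights differ by about `R / B ^ l`. -/
def Descending (R B : ℕ) (a : ℕ → ℝ) (m : ℕ) : Prop :=
  ∀ l < m, a l + R / (B : ℝ) ^ (l + 1) ≤ a (l + 1) ∧
    a (l + 1) ≤ a l + 2 * R / (B : ℝ) ^ (l + 1)

section Descending

variable {R B m : ℕ} {a : ℕ → ℝ}

theorem Descending.add_le (h : Descending R B a m) {i j : ℕ} (hij : i < j) (hj : j ≤ m) :
    a i + R / (B : ℝ) ^ (i + 1) ≤ a j := by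
  induction j, hij using Nat.le_induction with
  | base => exact (h i hj).1
  | succ j hij ih =>
    have h1 := ih (by omega)
    have h2 := (h j hj).1
    have : 0 ≤ R / (B : ℝ) ^ (j + 1) := by positivity
    linarith

/-- The remaining gaps are dominated by a geometric series of ratio `1 / B ≤ 1 / 2`, which at most
doubles the bound on the first one. -/
theorem Descending.le_add (h : Descending R B a m) (hB : 2 ≤ B) {i : ℕ} (hi : i ≤ m) :
    a m ≤ a i + 4 * R / (B : ℝ) ^ (i + 1) := by
  induction hi using Nat.decreasingInduction with
  | self => simp; positivity
  | of_succ i hi ih =>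
    have h1 := (h i hi).2
    have hB' : (2 : ℝ) ≤ B := by exact_mod_cast hB
    have h2 : 4 * (R : ℝ) / (B : ℝ) ^ (i + 1 + 1) ≤ 2 * R / (B : ℝ) ^ (i + 1) := by
      rw [div_le_div_iff₀ (by positivity) (by positivity), pow_succ (B : ℝ) (i + 1)]
      have : 0 ≤ R * (B : ℝ) ^ (i + 1) := by positivity
      nlinarith
    have h3 : 4 * (R : ℝ) / (B : ℝ) ^ (i + 1) =
      2 * R / (B : ℝ) ^ (i + 1) + 2 * R / (B : ℝ) ^ (i + 1) := by ring
    linarith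

theorem Descending.lt (h : Descending R B a m) (hR : 0 < R) (hB : 0 < B) {i j : ℕ}
    (hij : i < j) (hj : j ≤ m) : a i < a j := by
  have := h.add_le hij hj
  have : 0 < R / (B : ℝ) ^ (i + 1) := by positivity
  linarith

theorem Descending.nodup_rows {d : ℕ} (hd : 2 ≤ d) (h : Descending R B a m) (hR : 0 < R)
    (hB : 0 < B) {i : ℕ} (hi : i ≤ m) : (rows B a i : List (Point d)).Nodup := by
  induction i with
  | zero => exact nodup_row hd (by positivity) _
  | succ i ih =>
    refine List.Nodup.append (ih (by omega)) (nodup_row hd (by positivity) _) ?_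
    intro p hp hp'
    obtain ⟨l, hl, hp⟩ := mem_rows.1 hp
    obtain ⟨j, -, rfl⟩ := mem_row.1 hp
    obtain ⟨k, -, hk⟩ := mem_row.1 hp'
    exact (h.lt hR hB (Nat.lt_succ_of_le hl) hi).ne' (planePoint_injective hd hk).2

end Descending

/-- The adversary: every algorithm can be forced to build a graph of length `i / 4` on `i + 1`
rows whose heights are chosen adaptively. -/
theorem OnlineAlgorithm.exists_rows_le_hausdorffMeasure {d : ℕ} (hd : 2 ≤ d) {t : ℝ}
    (A : OnlineAlgorithm d t) {R B : ℕ} (hR : 0 < R) (hB : 0 < B) {i : ℕ} (hi : i ≤ R) :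
    ∃ a : ℕ → ℝ, Descending R B a i ∧
      ENNReal.ofReal (i / 4) ≤ μH[1] (A.output (rows B a i)).carrier := by
  induction i with
  | zero => exact ⟨fun _ => 0, fun l hl => absurd hl l.not_lt_zero, by simp⟩
  | succ i ih =>
    obtain ⟨a, ha, hμ⟩ := ih (by omega)
    have hBpos : (0 : ℝ) < (B : ℝ) ^ (i + 1) := by positivity
    have key : ∀ r : ℕ, R ≤ r → r ≤ 2 * R → ∀ y, y = a i + r / (B : ℝ) ^ (i + 1) →
        ∃ a', Descending R B a' (i + 1) ∧
          (rows B a' (i + 1) : List (Point d)) = rows B a i ++ row (B ^ (i + 1)) y := by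
      rintro r hr hr' y rfl
      refine ⟨Function.update a (i + 1) (a i + r / (B : ℝ) ^ (i + 1)), fun l hl => ?_, ?_⟩
      · rw [Function.update_of_ne (by omega)]
        rcases Nat.lt_succ_iff_lt_or_eq.1 hl with hl | rfl
        · rw [Function.update_of_ne (by omega)]
          exact ha l hl
        · rw [Function.update_self]
          have h1 : (R : ℝ) ≤ r := by exact_mod_cast hr
          have h2 : (r : ℝ) ≤ 2 * R := by exact_mod_cast hr'
          exact ⟨by gcongr, by gcongr⟩
      · rw [rows, Function.update_self]
        congr 1
        exact rows_congr B fun l hl => Function.update_of_ne (by omega) _ _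
    by_cases hK : μH[1] (A.output (rows B a i)).carrier ≤ ENNReal.ofReal (R / 4)
    -- With this `δ` the candidate heights are `a i + r / B ^ (i + 1)`, and `R ≤ r ≤ 2 * R` is
    -- exactly the allowed range of gaps.
    · obtain ⟨r, hr, hr', hstrip⟩ := exists_hausdorffMeasure_strip_inter_le hd hR hK (a i)
        (δ := 1 / (2 * ((B ^ (i + 1) : ℕ) : ℝ))) (by positivity)
      obtain ⟨a', ha', he⟩ := key r hr hr'
        (a i + r * (2 * (1 / (2 * ((B ^ (i + 1) : ℕ) : ℝ))))) (by push_cast; field_simp)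
      have hnd := ha'.nodup_rows hd hR hB le_rfl
      rw [he] at hnd
      refine ⟨a', ha', ?_⟩
      rw [he]
      refine le_trans ?_ (A.hausdorffMeasure_carrier_append_row hd (by positivity) hnd hstrip)
      calc ENNReal.ofReal ((i + 1 : ℕ) / 4)
          = ENNReal.ofReal (i / 4) + ENNReal.ofReal (1 / 4) := by
            rw [← ENNReal.ofReal_add (by positivity) (by norm_num)]
            push_cast
            ring_nf
        _ ≤ _ := by gcongr
    -- The graph is already longer than `R / 4`, the final target, so any admissible height will do.
    · obtain ⟨a', ha', he⟩ := key R le_rfl (by omega) _ rfl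
      have hnd := ha'.nodup_rows hd hR hB le_rfl
      rw [he] at hnd
      refine ⟨a', ha', ?_⟩
      rw [he]
      refine le_trans ?_ ((not_le.1 hK).le.trans
        (measure_mono (A.carrier_subset_append _ _ hnd)))
      have : ((i + 1 : ℕ) : ℝ) ≤ R := by exact_mod_cast hi
      gcongr

end OnlineSpanner

/-! ### Walks of bounded weight and graphs given by lists of pairs. -/

namespace OnlineSpanner

namespace GeomGraph

variable {d : ℕ}

/-- `v` can be reached from `u` in `G` by a walk of weight at most `c`. -/
def Reach (G : GeomGraph d) (u v : Point d) (c : ℝ) : Prop :=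
  ∃ p : G.graph.Walk u v, G.walkWeight p ≤ c

namespace Reach

variable {G : GeomGraph d} {u v w : Point d} {c c' : ℝ}

theorem refl (G : GeomGraph d) (u : Point d) : G.Reach u u 0 :=
  ⟨SimpleGraph.Walk.nil, by simp [walkWeight]⟩

theorem mono (h : G.Reach u v c) (hc : c ≤ c') : G.Reach u v c' :=
  let ⟨p, hp⟩ := h
  ⟨p, hp.trans hc⟩

theorem symm (h : G.Reach u v c) : G.Reach v u c := by
  obtain ⟨p, hp⟩ := h
  refine ⟨p.reverse, ?_⟩
  simpa [walkWeight, List.sum_reverse] using hp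

theorem trans (h : G.Reach u v c) (h' : G.Reach v w c') : G.Reach u w (c + c') := by
  obtain ⟨p, hp⟩ := h
  obtain ⟨q, hq⟩ := h'
  refine ⟨p.append q, ?_⟩
  simp only [walkWeight, SimpleGraph.Walk.edges_append, List.map_append, List.sum_append] at *
  linarith

end Reach

open Classical in
/-- The graph whose edges join the given pairs of points. -/
noncomputable def ofPairs (T : Finset (Point d × Point d)) : GeomGraph d where
  verts := T.image Prod.fst ∪ T.image Prod.snd
  edges := (T.image fun p => s(p.1, p.2)).filter fun e => ¬ e.IsDiag
  not_isDiag e he := (Finset.mem_filter.1 he).2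
  mem_verts e he v hv := by
    obtain ⟨p, hp, rfl⟩ := Finset.mem_image.1 (Finset.mem_filter.1 he).1
    rcases Sym2.mem_iff.1 hv with rfl | rfl
    · exact Finset.mem_union_left _ (Finset.mem_image_of_mem _ hp)
    · exact Finset.mem_union_right _ (Finset.mem_image_of_mem _ hp)

theorem weight_ofPairs_le (T : Finset (Point d × Point d)) :
    (ofPairs T).weight ≤ ∑ p ∈ T, dist p.1 p.2 := by
  classical
  calc (ofPairs T).weight
      ≤ ∑ e ∈ T.image fun p => s(p.1, p.2), edgeWeight e := by
        refine Finset.sum_le_sum_of_subset_of_nonneg ?_ fun e _ _ => edgeWeight_nonneg e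
        exact Finset.filter_subset _ _
    _ ≤ ∑ p ∈ T, edgeWeight s(p.1, p.2) :=
        Finset.sum_image_le_of_nonneg fun e _ => edgeWeight_nonneg e
    _ = _ := rfl

theorem left_mem_verts_ofPairs {T : Finset (Point d × Point d)} {u v : Point d}
    (h : (u, v) ∈ T) : u ∈ (ofPairs T).verts := by
  classical
  exact Finset.mem_union_left _ (Finset.mem_image_of_mem Prod.fst h)

theorem right_mem_verts_ofPairs {T : Finset (Point d × Point d)} {u v : Point d}
    (h : (u, v) ∈ T) : v ∈ (ofPairs T).verts := by
  classical
  exact Finset.mem_union_right _ (Finset.mem_image_of_mem Prod.snd h)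

theorem reach_ofPairs {T : Finset (Point d × Point d)} {u v : Point d} (h : (u, v) ∈ T) :
    (ofPairs T).Reach u v (dist u v) := by
  classical
  -- A degenerate pair contributes no edge; the trivial walk replaces it.
  by_cases huv : u = v
  · subst huv
    rw [dist_self]
    exact Reach.refl _ _
  · have hadj : (ofPairs T).graph.Adj u v := by
      refine (SimpleGraph.fromEdgeSet_adj _).2 ⟨?_, huv⟩
      refine Finset.mem_coe.2 (Finset.mem_filter.2 ⟨Finset.mem_image.2 ⟨_, h, rfl⟩, ?_⟩)
      simpa using huv
    exact ⟨hadj.toWalk, by simp [walkWeight, edgeWeight]⟩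

end GeomGraph

/-! ### The offline comb and its weight. -/

section Comb

/-- The abscissae `k / D` with `0 ≤ k ≤ D`. -/
def OnGrid (D : ℕ) (x : ℝ) : Prop := ∃ k : ℕ, k ≤ D ∧ x = k / D

theorem OnGrid.nonneg {D : ℕ} {x : ℝ} (h : OnGrid D x) : 0 ≤ x := by
  obtain ⟨k, -, rfl⟩ := h
  positivity

theorem OnGrid.le_one {D : ℕ} {x : ℝ} (h : OnGrid D x) : x ≤ 1 := by
  obtain ⟨k, hk, rfl⟩ := h
  exact div_le_one_of_le₀ (by exact_mod_cast hk) (by positivity)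

theorem OnGrid.of_dvd {D D' : ℕ} {x : ℝ} (h : OnGrid D x) (hD : D ∣ D') (hD' : 0 < D') :
    OnGrid D' x := by
  obtain ⟨c, rfl⟩ := hD
  obtain ⟨k, hk, rfl⟩ := h
  have hc : (c : ℝ) ≠ 0 := by
    rintro h
    rw [Nat.cast_eq_zero] at h
    simp [h] at hD'
  refine ⟨k * c, Nat.mul_le_mul_right _ hk, ?_⟩
  push_cast
  rw [mul_div_mul_right _ _ hc]

variable {d : ℕ}

/-- The edges of the path with `D + 1` vertices on the segment from `(0, b)` to `(1, b)`. -/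
noncomputable def pathPairs (D : ℕ) (b : ℝ) (k : ℕ) : Point d × Point d :=
  (planePoint ((k : ℝ) / D) b, planePoint ((k + 1 : ℕ) / D) b)

/-- The edges of the fan from the `j`-th point of the `i`-th row to the line at height `a m`. -/
noncomputable def fanPairs (B : ℕ) (a : ℕ → ℝ) (m : ℕ) (q : Σ _ : ℕ, ℕ × ℤ) :
    Point d × Point d :=
  (planePoint ((q.2.1 : ℝ) / (B : ℝ) ^ q.1) (a q.1),
    planePoint (((q.2.1 : ℝ) * B + q.2.2) / (B : ℝ) ^ (q.1 + 1)) (a m))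

open Classical in
/-- A path along the line at height `a m`, with fans from the points of the rows before. -/
noncomputable def combPairs (B F : ℕ) (a : ℕ → ℝ) (m D : ℕ) : Finset (Point d × Point d) :=
  (Finset.range D).image (pathPairs D (a m)) ∪
    ((Finset.range m).sigma fun i => Finset.range (B ^ i + 1) ×ˢ Finset.Icc (-F : ℤ) F).image
      (fanPairs B a m)

theorem pathPairs_mem_combPairs {B F : ℕ} {a : ℕ → ℝ} {m D k : ℕ} (hk : k < D) :
    (pathPairs D (a m) k : Point d × Point d) ∈ combPairs B F a m D := by
  classical
  exact Finset.mem_union_left _ (Finset.mem_image_of_mem _ (Finset.mem_range.2 hk))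

theorem fanPairs_mem_combPairs {B F : ℕ} {a : ℕ → ℝ} {m D i j : ℕ} {z : ℤ} (hi : i < m)
    (hj : j ≤ B ^ i) (hz : |z| ≤ F) :
    (fanPairs B a m ⟨i, j, z⟩ : Point d × Point d) ∈ combPairs B F a m D := by
  classical
  refine Finset.mem_union_right _ (Finset.mem_image_of_mem _ ?_)
  rw [abs_le] at hz
  simp only [Finset.mem_sigma, Finset.mem_range, Finset.mem_product, Finset.mem_Icc]
  exact ⟨hi, Nat.lt_succ_of_le hj, hz⟩

/-- The path costs at most 1 for every `D`. At level `i` there are at most `2 * B ^ i * (2 * F + 1)`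
fan edges of length at most `(F + 4 * R) / B ^ (i + 1)`, so the level's cost does not depend on `i`,
and `hBF` makes the `m` levels sum to at most 1. -/
theorem sum_dist_combPairs_le (hd : 2 ≤ d) {R B F m D : ℕ} {a : ℕ → ℝ}
    (ha : Descending R B a m) (hB : 2 ≤ B) (hBF : 2 * m * (2 * F + 1) * (F + 4 * R) ≤ B) :
    ∑ p ∈ (combPairs B F a m D : Finset (Point d × Point d)), dist p.1 p.2 ≤ 2 := by
  classical
  have hB0 : (0 : ℝ) < B := by positivity
  have hpath : ∀ k ∈ Finset.range D,
      dist (pathPairs D (a m) k : Point d × Point d).1 (pathPairs D (a m) k).2 ≤ 1 / D := by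
    intro k _
    rw [pathPairs, dist_planePoint_horizontal hd, abs_sub_comm, ← sub_div]
    push_cast
    rw [add_sub_cancel_left, abs_of_nonneg (by positivity)]
  have hfan : ∀ i < m, ∀ q ∈ Finset.range (B ^ i + 1) ×ˢ Finset.Icc (-F : ℤ) F,
      dist (fanPairs B a m ⟨i, q⟩ : Point d × Point d).1 (fanPairs B a m ⟨i, q⟩).2 ≤
        (F + 4 * R) / (B : ℝ) ^ (i + 1) := by
    rintro i hi ⟨j, z⟩ hq
    simp only [Finset.mem_product, Finset.mem_Icc, ← abs_le] at hq
    have hz : |(z : ℝ)| ≤ F := by exact_mod_cast hq.2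
    refine (dist_planePoint_le hd _ _ _ _).trans ?_
    have h1 : (j : ℝ) / (B : ℝ) ^ i - (j * B + z) / (B : ℝ) ^ (i + 1) =
        -z / (B : ℝ) ^ (i + 1) := by
      field_simp
      ring
    have h2 : |a i - a m| ≤ 4 * R / (B : ℝ) ^ (i + 1) := by
      have := ha.le_add hB hi.le
      have h3 := ha.add_le hi le_rfl
      have : 0 ≤ R / (B : ℝ) ^ (i + 1) := by positivity
      rw [abs_le]
      constructor <;> linarith
    dsimp only
    rw [h1, abs_div, abs_neg, abs_of_pos (by positivity : (0 : ℝ) < (B : ℝ) ^ (i + 1)), add_div]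
    gcongr
  have hlevel : ∀ i ∈ Finset.range m,
      ∑ q ∈ Finset.range (B ^ i + 1) ×ˢ Finset.Icc (-F : ℤ) F,
        dist (fanPairs B a m ⟨i, q⟩ : Point d × Point d).1 (fanPairs B a m ⟨i, q⟩).2 ≤
          2 * (2 * F + 1) * (F + 4 * R) / B := by
    intro i hi
    refine (Finset.sum_le_card_nsmul _ _ _ (hfan i (Finset.mem_range.1 hi))).trans ?_
    have hcard : (Finset.Icc (-F : ℤ) F).card = 2 * F + 1 := by
      rw [Int.card_Icc]
      omega
    rw [Finset.card_product, Finset.card_range, hcard, nsmul_eq_mul, mul_div_assoc']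
    rw [div_le_div_iff₀ (by positivity) hB0]
    push_cast
    have h1 : (1 : ℝ) ≤ (B : ℝ) ^ i := one_le_pow₀ (by exact_mod_cast (by omega : 1 ≤ B))
    calc ((B : ℝ) ^ i + 1) * (2 * F + 1) * (F + 4 * R) * B
        ≤ ((B : ℝ) ^ i + (B : ℝ) ^ i) * (2 * F + 1) * (F + 4 * R) * B := by gcongr
      _ = _ := by ring
  have hnonneg : ∀ p : Point d × Point d, 0 ≤ dist p.1 p.2 := fun _ => dist_nonneg
  have hunion : ∀ s t : Finset (Point d × Point d),
      ∑ p ∈ s ∪ t, dist p.1 p.2 ≤ ∑ p ∈ s, dist p.1 p.2 + ∑ p ∈ t, dist p.1 p.2 := by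
    intro s t
    rw [← Finset.sum_union_inter]
    exact le_add_of_nonneg_right (Finset.sum_nonneg fun p _ => hnonneg p)
  refine (hunion _ _).trans ?_
  refine (add_le_add (b := 1) (d := 1) ?_ ?_).trans one_add_one_eq_two.le
  · refine (Finset.sum_image_le_of_nonneg fun p _ => hnonneg p).trans ?_
    refine (Finset.sum_le_card_nsmul _ _ _ hpath).trans ?_
    rw [Finset.card_range, nsmul_eq_mul, mul_one_div]
    exact div_self_le_one _
  · refine (Finset.sum_image_le_of_nonneg fun p _ => hnonneg p).trans ?_
    rw [Finset.sum_sigma]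
    refine (Finset.sum_le_card_nsmul _ _ _ hlevel).trans ?_
    rw [Finset.card_range, nsmul_eq_mul, mul_div_assoc', div_le_one hB0]
    have : ((2 * m * (2 * F + 1) * (F + 4 * R) : ℕ) : ℝ) ≤ B := by exact_mod_cast hBF
    push_cast at this
    linarith

end Comb

end OnlineSpanner

/-! ### The comb has stretch at most `1 + ε`. -/

namespace OnlineSpanner

open GeomGraph

section CombSpanner

variable {d : ℕ}

theorem reach_path (hd : 2 ≤ d) {G : GeomGraph d} {D : ℕ} {b : ℝ}
    (hG : ∀ k < D, G.Reach (pathPairs D b k).1 (pathPairs D b k).2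
      (dist (pathPairs D b k : Point d × Point d).1 (pathPairs D b k).2))
    {x x' : ℝ} (hx : OnGrid D x) (hx' : OnGrid D x') :
    G.Reach (planePoint x b) (planePoint x' b) |x - x'| := by
  have key : ∀ k l : ℕ, k ≤ l → l ≤ D →
      G.Reach (planePoint ((k : ℝ) / D) b) (planePoint ((l : ℝ) / D) b)
        ((l : ℝ) / D - (k : ℝ) / D) := by
    intro k l hkl
    induction l, hkl using Nat.le_induction with
    | base => exact fun _ => by simpa using Reach.refl G _
    | succ l hkl ih =>
      intro hl
      refine ((ih (by omega)).trans (hG l hl)).mono (le_of_eq ?_)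
      rw [pathPairs, dist_planePoint_horizontal hd, abs_sub_comm, abs_of_nonneg]
      · ring
      · rw [← sub_div]
        push_cast
        rw [add_sub_cancel_left]
        positivity
  obtain ⟨k, hk, rfl⟩ := hx
  obtain ⟨l, hl, rfl⟩ := hx'
  rcases le_total k l with h | h
  · have h' : (k : ℝ) / D ≤ l / D := by gcongr
    rw [abs_sub_comm, abs_of_nonneg (sub_nonneg.2 h')]
    exact key k l h hl
  · have h' : (l : ℝ) / D ≤ k / D := by gcongr
    rw [abs_of_nonneg (sub_nonneg.2 h')]
    exact (key l k h hk).symm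

/-- From a point of the `i`-th row one reaches, with stretch `1 + ε`, every point that lies
much closer to the line at height `a m`. -/
theorem reach_of_fan (hd : 2 ≤ d) {ε : ℝ} (hε : 0 < ε) {G : GeomGraph d} {R B F m D : ℕ}
    {a : ℕ → ℝ} (ha : Descending R B a m) (hB : 2 ≤ B) (hR : 4 ≤ ε * R) (hF : 8 * R ≤ ε * F)
    (hεB : 16 ≤ ε * B)
    (hD : ∀ i ≤ m, ∀ x, OnGrid (B ^ i) x → OnGrid D x)
    (hline : ∀ x x', OnGrid D x → OnGrid D x' →
      G.Reach (planePoint x (a m)) (planePoint x' (a m)) |x - x'|)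
    (hfan : ∀ i < m, ∀ j ≤ B ^ i, ∀ z : ℤ, |z| ≤ F →
      G.Reach (fanPairs B a m ⟨i, j, z⟩).1 (fanPairs B a m ⟨i, j, z⟩).2
        (dist (fanPairs B a m ⟨i, j, z⟩ : Point d × Point d).1 (fanPairs B a m ⟨i, j, z⟩).2))
    {i j : ℕ} (hi : i < m) (hj : j ≤ B ^ i) {x y : ℝ} (hx : OnGrid D x)
    (hy : a i + R / (B : ℝ) ^ (i + 1) ≤ y)
    (hym : |a m - y| ≤ 4 * R / (B : ℝ) ^ (i + 2))
    (hfoot : G.Reach (planePoint x y) (planePoint x (a m)) |a m - y|) :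
    G.Reach (planePoint ((j : ℝ) / (B : ℝ) ^ i) (a i)) (planePoint x y)
      ((1 + ε) * dist (planePoint ((j : ℝ) / (B : ℝ) ^ i) (a i) : Point d) (planePoint x y)) := by
  have hB0 : (0 : ℝ) < B := by positivity
  set δ : ℝ := 1 / (B : ℝ) ^ (i + 1) with hδ
  have hδ0 : 0 < δ := by positivity
  set u : Point d := planePoint ((j : ℝ) / (B : ℝ) ^ i) (a i) with hu
  set Δ := dist u (planePoint x y) with hΔ
  have hRδ : R * δ ≤ Δ := by
    have h1 := abs_sub_snd_le_dist hd ((j : ℝ) / (B : ℝ) ^ i) (a i) x y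
    have h2 := neg_abs_le (a i - y)
    have h3 : R * δ = R / (B : ℝ) ^ (i + 1) := by rw [hδ, mul_one_div]
    linarith
  -- The target is closer to the line by a factor of order `B` than the rows are to each other, so
  -- its vertical detour is negligible.
  have hη : |a m - y| ≤ ε / 4 * Δ := by
    refine hym.trans ?_
    have h1 : 4 * R / (B : ℝ) ^ (i + 2) = 4 * R * δ / B := by
      rw [hδ, pow_succ (B : ℝ) (i + 1)]
      field_simp
    rw [h1, div_le_iff₀ hB0]
    have h2 : 4 * (R * δ) ≤ 4 * Δ := by linarith
    nlinarith [dist_nonneg (x := u) (y := planePoint x y)]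
  have hX : |(j : ℝ) / (B : ℝ) ^ i - x| ≤ Δ := abs_sub_fst_le_dist hd _ _ _ _
  have hgrid : OnGrid D ((j : ℝ) / (B : ℝ) ^ i) := hD i hi.le _ ⟨j, hj, by push_cast; rfl⟩
  -- Near case: the fan edge to the mesh point just left of `x` almost points at the target. The
  -- walk has weight at most `Δ + 2 * |a m - y| + 2 * δ`, and each of the two errors is at most `ε /
  -- 2 * Δ`; for `δ` this uses `R * δ ≤ Δ` and `4 ≤ ε * R`.
  by_cases hnear : |(j : ℝ) / (B : ℝ) ^ i - x| ≤ F * δ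
  · have hjδ : (j : ℝ) / (B : ℝ) ^ i = j * B * δ := by
      rw [hδ, pow_succ]
      field_simp
    obtain ⟨h1, h2⟩ := abs_le.1 hnear
    rw [hjδ] at h1 h2
    have hxδ : x / δ * δ = x := div_mul_cancel₀ _ hδ0.ne'
    have hk1 := Int.floor_le (x / δ)
    have hk2 := Int.lt_floor_add_one (x / δ)
    have hk0 : 0 ≤ ⌊x / δ⌋ := Int.floor_nonneg.2 (div_nonneg hx.nonneg hδ0.le)
    obtain ⟨k, hk⟩ := Int.eq_ofNat_of_zero_le hk0
    have hlo : (j : ℤ) * B - F ≤ ⌊x / δ⌋ := by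
      rw [Int.le_floor, le_div_iff₀ hδ0]
      push_cast
      linarith
    have hhi : (⌊x / δ⌋ : ℝ) ≤ j * B + F := by
      refine hk1.trans ?_
      rw [div_le_iff₀ hδ0]
      linarith
    have hhi' : ⌊x / δ⌋ ≤ (j : ℤ) * B + F := by exact_mod_cast hhi
    have hkB : k ≤ B ^ (i + 1) := by
      have h3 : x / δ ≤ (B : ℝ) ^ (i + 1) := by
        rw [hδ, div_div_eq_mul_div, div_one]
        exact mul_le_of_le_one_left (by positivity) hx.le_one
      have h4 : (⌊x / δ⌋ : ℝ) ≤ (B : ℝ) ^ (i + 1) := hk1.trans h3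
      rw [hk] at h4
      exact_mod_cast h4
    rw [hk] at hk1 hk2 hlo hhi'
    push_cast at hk1 hk2
    have hg := hfan i hi j hj ((k : ℤ) - j * B) (by rw [abs_le]; constructor <;> linarith)
    have hgk : ((j : ℝ) * B + (((k : ℤ) - j * B : ℤ) : ℝ)) / (B : ℝ) ^ (i + 1) =
        k / (B : ℝ) ^ (i + 1) := by
      push_cast
      ring
    simp only [fanPairs, hgk, ← hu] at hg
    set g : Point d := planePoint ((k : ℝ) / (B : ℝ) ^ (i + 1)) (a m) with hgdef
    have hgx : |(k : ℝ) / (B : ℝ) ^ (i + 1) - x| ≤ δ := by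
      have h3 : (k : ℝ) / (B : ℝ) ^ (i + 1) = k * δ := by rw [hδ, mul_one_div]
      rw [h3, abs_le]
      rw [le_div_iff₀ hδ0] at hk1
      rw [div_lt_iff₀ hδ0] at hk2
      constructor <;> linarith
    have hgl := hline _ x (hD (i + 1) hi _ ⟨k, hkB, by push_cast; rfl⟩) hx
    refine ((hg.trans hgl).trans hfoot.symm).mono ?_
    have h5 : dist u g ≤ Δ + |a m - y| + δ := by
      have h6 := dist_triangle4 u (planePoint x y) (planePoint x (a m)) g
      rw [dist_planePoint_vertical hd, dist_planePoint_horizontal hd, abs_sub_comm y,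
        abs_sub_comm x] at h6
      linarith
    have h7 : 2 * δ ≤ ε / 2 * Δ := by nlinarith
    linarith
  -- Far case: the horizontal offset exceeds `F * δ`, so by `hF` the vertical edge costs at most `ε
  -- / 2 * Δ`, and following the line costs at most `Δ`.
  · have hg := hfan i hi j hj 0 (by simp)
    have hgk : ((j : ℝ) * B + ((0 : ℤ) : ℝ)) / (B : ℝ) ^ (i + 1) = (j : ℝ) / (B : ℝ) ^ i := by
      push_cast
      rw [pow_succ]
      field_simp
      ring
    simp only [fanPairs, hgk, dist_planePoint_vertical hd] at hg
    rw [← hu] at hg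
    refine ((hg.trans (hline _ x hgrid hx)).trans hfoot.symm).mono ?_
    have h1 : |a i - a m| ≤ 4 * R * δ := by
      have h2 := ha.le_add hB hi.le
      have h3 := ha.add_le hi le_rfl
      have : 0 ≤ R / (B : ℝ) ^ (i + 1) := by positivity
      rw [hδ, mul_one_div, abs_le]
      constructor <;> linarith
    have h4 : 4 * R * δ ≤ ε / 2 * Δ := by
      have : F * δ ≤ Δ := (not_le.1 hnear).le.trans hX
      nlinarith
    have : 0 ≤ ε / 4 * Δ := by positivity
    linarith

/-- The offline solution: a spanner of weight at most `2` for all rows. -/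
theorem exists_isSteinerSpanner_weight_le_two (hd : 2 ≤ d) {ε : ℝ} (hε : 0 < ε)
    {R B F m D : ℕ} {a : ℕ → ℝ} (ha : Descending R B a m) (hB : 2 ≤ B) (hR : 4 ≤ ε * R)
    (hF : 8 * R ≤ ε * F) (hεB : 16 ≤ ε * B) (hεB' : 8 * R ≤ ε * B)
    (hBF : 2 * m * (2 * F + 1) * (F + 4 * R) ≤ B) (hD0 : 0 < D) (hD : B ^ m ∣ D) :
    ∃ G : GeomGraph d, G.weight ≤ 2 ∧ G.IsSteinerSpanner (1 + ε)
      {p | p ∈ rows B a m ∨ p ∈ row D (a m)} := by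
  set T : Finset (Point d × Point d) := combPairs B F a m D with hT
  set G := ofPairs T with hG
  have hB0 : (0 : ℝ) < B := by positivity
  have hgrid : ∀ i ≤ m, ∀ x, OnGrid (B ^ i) x → OnGrid D x := fun i hi x hx =>
    hx.of_dvd ((pow_dvd_pow B hi).trans hD) hD0
  have hline : ∀ x x', OnGrid D x → OnGrid D x' →
      G.Reach (planePoint x (a m)) (planePoint x' (a m)) |x - x'| := fun x x' hx hx' =>
    reach_path hd (fun k hk => reach_ofPairs (pathPairs_mem_combPairs hk)) hx hx'
  have hfan : ∀ i < m, ∀ j ≤ B ^ i, ∀ z : ℤ, |z| ≤ F →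
      G.Reach (fanPairs B a m ⟨i, j, z⟩).1 (fanPairs B a m ⟨i, j, z⟩).2
        (dist (fanPairs B a m ⟨i, j, z⟩ : Point d × Point d).1 (fanPairs B a m ⟨i, j, z⟩).2) :=
    fun i hi j hj z hz => reach_ofPairs (fanPairs_mem_combPairs hi hj hz)
  have hfoot : ∀ i < m, ∀ j ≤ B ^ i,
      G.Reach (planePoint ((j : ℝ) / (B : ℝ) ^ i) (a i))
        (planePoint ((j : ℝ) / (B : ℝ) ^ i) (a m)) |a m - a i| := by
    intro i hi j hj
    have hg := hfan i hi j hj 0 (by simp)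
    have hgk : ((j : ℝ) * B + ((0 : ℤ) : ℝ)) / (B : ℝ) ^ (i + 1) = (j : ℝ) / (B : ℝ) ^ i := by
      push_cast
      rw [pow_succ]
      field_simp
      ring
    simp only [fanPairs, hgk, dist_planePoint_vertical hd] at hg
    rwa [abs_sub_comm]
  have habs : ∀ i ≤ m, |a m - a i| ≤ 4 * R / (B : ℝ) ^ (i + 1) := by
    intro i hi
    have h2 := ha.le_add hB hi
    have h3 : a i ≤ a m := by
      rcases hi.lt_or_eq with hi | rfl
      · have := ha.add_le hi le_rfl
        have : 0 ≤ R / (B : ℝ) ^ (i + 1) := by positivity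
        linarith
      · exact le_rfl
    rw [abs_le]
    constructor <;> linarith [show (0 : ℝ) ≤ 4 * R / (B : ℝ) ^ (i + 1) by positivity]
  have hcases : ∀ p : Point d, p ∈ rows B a m ∨ p ∈ row D (a m) →
      (∃ i < m, ∃ j ≤ B ^ i, p = planePoint ((j : ℝ) / (B : ℝ) ^ i) (a i)) ∨
        ∃ x, OnGrid D x ∧ p = planePoint x (a m) := by
    rintro p (hp | hp)
    · obtain ⟨i, hi, hp⟩ := mem_rows.1 hp
      obtain ⟨j, hj, rfl⟩ := mem_row.1 hp
      rcases hi.lt_or_eq with hi | rfl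
      · exact Or.inl ⟨i, hi, j, hj, by push_cast; rfl⟩
      · exact Or.inr ⟨_, hgrid _ le_rfl _ ⟨j, hj, rfl⟩, rfl⟩
    · obtain ⟨j, hj, rfl⟩ := mem_row.1 hp
      exact Or.inr ⟨_, ⟨j, hj, rfl⟩, rfl⟩
  have hlow : ∀ i < m, ∀ j ≤ B ^ i, ∀ i' < m, ∀ j' ≤ B ^ i', i < i' →
      G.Reach (planePoint ((j : ℝ) / (B : ℝ) ^ i) (a i))
        (planePoint ((j' : ℝ) / (B : ℝ) ^ i') (a i'))
        ((1 + ε) * dist (planePoint ((j : ℝ) / (B : ℝ) ^ i) (a i) : Point d)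
          (planePoint ((j' : ℝ) / (B : ℝ) ^ i') (a i'))) := by
    intro i hi j hj i' hi' j' hj' hii
    refine reach_of_fan hd hε ha hB hR hF hεB hgrid hline hfan hi hj
      (hgrid i' hi'.le _ ⟨j', hj', by push_cast; rfl⟩) (ha.add_le hii hi'.le)
      ((habs i' hi'.le).trans ?_) (hfoot i' hi' j' hj')
    have h1 : (1 : ℝ) ≤ B := by exact_mod_cast (by omega : 1 ≤ B)
    have h2 : (B : ℝ) ^ (i + 2) ≤ (B : ℝ) ^ (i' + 1) := pow_le_pow_right₀ h1 (by omega)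
    gcongr
  have hline' : ∀ i < m, ∀ j ≤ B ^ i, ∀ x, OnGrid D x →
      G.Reach (planePoint ((j : ℝ) / (B : ℝ) ^ i) (a i)) (planePoint x (a m))
        ((1 + ε) * dist (planePoint ((j : ℝ) / (B : ℝ) ^ i) (a i) : Point d)
          (planePoint x (a m))) := by
    intro i hi j hj x hx
    refine reach_of_fan hd hε ha hB hR hF hεB hgrid hline hfan hi hj hx (ha.add_le hi le_rfl) ?_ ?_
    · rw [sub_self, abs_zero]
      positivity
    · rw [sub_self, abs_zero]
      exact Reach.refl G _
  refine ⟨G, (weight_ofPairs_le T).trans (sum_dist_combPairs_le hd ha hB hBF), ?_, ?_⟩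
  · intro p hp
    rcases hcases p hp with ⟨i, hi, j, hj, rfl⟩ | ⟨x, ⟨k, hk, rfl⟩, rfl⟩
    · exact left_mem_verts_ofPairs (fanPairs_mem_combPairs (z := 0) hi hj (by simp))
    · rcases hk.lt_or_eq with hk | rfl
      · exact left_mem_verts_ofPairs (pathPairs_mem_combPairs hk)
      · obtain ⟨k, rfl⟩ := Nat.exists_eq_succ_of_ne_zero hD0.ne'
        exact right_mem_verts_ofPairs (pathPairs_mem_combPairs k.lt_succ_self)
  · intro p hp q hq
    change G.Reach p q ((1 + ε) * dist p q)
    rcases hcases p hp with ⟨i, hi, j, hj, rfl⟩ | ⟨x, hx, rfl⟩ <;>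
      rcases hcases q hq with ⟨i', hi', j', hj', rfl⟩ | ⟨x', hx', rfl⟩
    · rcases lt_trichotomy i i' with hii | rfl | hii
      · exact hlow i hi j hj i' hi' j' hj' hii
      · by_cases hjj : j = j'
        · subst hjj
          rw [dist_self, mul_zero]
          exact Reach.refl G _
        -- Within a row the path goes vertically to the line and back. By `hεB'` both vertical parts
        -- together cost at most `ε` times the spacing of the row.
        · refine (((hfoot i hi j hj).trans (hline _ _
            (hgrid i hi.le _ ⟨j, hj, by push_cast; rfl⟩)
            (hgrid i hi.le _ ⟨j', hj', by push_cast; rfl⟩))).trans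
              (hfoot i hi j' hj').symm).mono ?_
          rw [dist_planePoint_horizontal hd]
          have h1 := habs i hi.le
          have h2 : (1 : ℝ) / (B : ℝ) ^ i ≤
              |(j : ℝ) / (B : ℝ) ^ i - (j' : ℝ) / (B : ℝ) ^ i| := by
            rw [← sub_div, abs_div, abs_of_pos (by positivity : (0 : ℝ) < (B : ℝ) ^ i)]
            gcongr
            have h3 : (1 : ℤ) ≤ |(j : ℤ) - j'| := Int.one_le_abs (by omega)
            exact_mod_cast h3
          have h4 : 2 * (4 * R / (B : ℝ) ^ (i + 1)) ≤ ε * (1 / (B : ℝ) ^ i) := by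
            rw [mul_one_div, mul_div_assoc', div_le_div_iff₀ (by positivity) (by positivity),
              pow_succ]
            have : 0 < (B : ℝ) ^ i := by positivity
            nlinarith
          nlinarith
      · rw [dist_comm]
        exact (hlow i' hi' j' hj' i hi j hj hii).symm
    · exact hline' i hi j hj x' hx'
    · rw [dist_comm]
      exact (hline' i' hi' j' hj' x hx).symm
    · refine (hline x x' hx hx').mono ?_
      rw [dist_planePoint_horizontal hd]
      nlinarith [abs_nonneg (x - x')]

end CombSpanner

end OnlineSpanner

/-! ### Padding to arbitrary length and choice of constants. -/

namespace OnlineSpanner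

open MeasureTheory Measure

/-- `e` further points on the line at height `y`, inside the first gap of `row N y`. -/
noncomputable def padding {d : ℕ} (N e : ℕ) (y : ℝ) : List (Point d) :=
  (List.range e).map fun s : ℕ => planePoint (((s + 1 : ℕ) : ℝ) / (N * (e + 1) : ℕ)) y

theorem mem_row_of_mem_padding {d : ℕ} {N e : ℕ} (hN : 0 < N) {y : ℝ} {p : Point d}
    (hp : p ∈ padding N e y) : p ∈ row (N * (e + 1)) y := by
  simp only [padding, List.mem_map, List.mem_range] at hp
  obtain ⟨s, hs, rfl⟩ := hp
  exact mem_row.2 ⟨s + 1, by nlinarith, rfl⟩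

theorem nodup_rows_append_padding {d : ℕ} (hd : 2 ≤ d) {R B m : ℕ} {a : ℕ → ℝ}
    (ha : Descending R B a m) (hR : 0 < R) (hB : 0 < B) (e : ℕ) :
    (rows B a m ++ padding (B ^ m) e (a m) : List (Point d)).Nodup := by
  have hD : ((B ^ m * (e + 1) : ℕ) : ℝ) ≠ 0 := by positivity
  refine List.Nodup.append (ha.nodup_rows hd hR hB le_rfl) ?_ ?_
  · refine List.Nodup.map (fun j k h => ?_) List.nodup_range
    have h1 := (div_left_inj' hD).1 (planePoint_injective hd h).1
    exact Nat.succ_injective (by exact_mod_cast h1)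
  · intro p hp hp'
    simp only [padding, List.mem_map, List.mem_range] at hp'
    obtain ⟨s, hs, rfl⟩ := hp'
    obtain ⟨l, hl, hp⟩ := mem_rows.1 hp
    obtain ⟨j, -, hj⟩ := mem_row.1 hp
    obtain ⟨hx, hy⟩ := planePoint_injective hd hj
    rcases hl.lt_or_eq with hl | rfl
    · exact (ha.lt hR hB hl le_rfl).ne hy
    · have hl0 : ((B ^ l : ℕ) : ℝ) ≠ 0 := by positivity
      -- A coincidence with a point of the last row would force `e + 1` to divide `s + 1`, although
      -- `s < e`.
      rw [div_eq_div_iff hl0 hD] at hx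
      have hx' : j * (B ^ l * (e + 1)) = (s + 1) * B ^ l := by exact_mod_cast hx
      have hx2 : j * (e + 1) = s + 1 :=
        Nat.eq_of_mul_eq_mul_right (pow_pos hB l) (by linarith)
      have hdvd : e + 1 ∣ s + 1 := Dvd.intro_left _ hx2
      have := Nat.le_of_dvd (Nat.succ_pos s) hdvd
      omega

theorem opt_le_of_isSteinerSpanner {d : ℕ} {t : ℝ} {S S' : Set (Point d)} {G : GeomGraph d}
    (hG : G.IsSteinerSpanner t S') (hS : S ⊆ S') : opt t S ≤ ENNReal.ofReal G.weight :=
  iInf₂_le G ⟨fun u hu => hG.1 u (hS hu), fun u hu v hv => hG.2 u (hS hu) v (hS hv)⟩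

theorem exists_forall_natCast_le_competitiveRatio {ε : ℝ} (hε : 0 < ε) {d : ℕ} (hd : 2 ≤ d)
    (M : ℕ) : ∃ n₀ : ℕ, ∀ n, n₀ ≤ n → ∀ A : OnlineAlgorithm d (1 + ε),
      (M : ℝ≥0∞) ≤ A.competitiveRatio n := by
  have hceil : ∀ c : ℝ, ∀ k : ℕ, ⌈c / ε⌉₊ ≤ k → c ≤ ε * k := by
    intro c k hk
    have h := Nat.ceil_le.1 hk
    rw [div_le_iff₀ hε] at h
    linarith
  -- `R` depends on `M` and `ε`, then `F` on `R` and `ε`, then `B` on all of them. The factor 8 pays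
  -- for online length `R / 4` against offline weight 2.
  obtain ⟨R, hR0, hRM, hRε⟩ : ∃ R : ℕ, 0 < R ∧ 8 * M ≤ R ∧ ⌈4 / ε⌉₊ ≤ R :=
    ⟨8 * M + ⌈4 / ε⌉₊ + 1, by omega, by omega, by omega⟩
  obtain ⟨F, hF⟩ : ∃ F : ℕ, ⌈8 * R / ε⌉₊ ≤ F := ⟨_, le_rfl⟩
  obtain ⟨B, hB, hB1, hB2, hB3⟩ : ∃ B : ℕ, 2 ≤ B ∧ ⌈16 / ε⌉₊ ≤ B ∧ ⌈8 * R / ε⌉₊ ≤ B ∧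
      2 * R * (2 * F + 1) * (F + 4 * R) ≤ B :=
    ⟨2 + ⌈16 / ε⌉₊ + ⌈8 * R / ε⌉₊ + 2 * R * (2 * F + 1) * (F + 4 * R),
      by omega, by omega, by omega, by omega⟩
  have hB0 : 0 < B := by omega
  refine ⟨∑ l ∈ Finset.range (R + 1), (B ^ l + 1), fun n hn A => ?_⟩
  obtain ⟨e, rfl⟩ := Nat.exists_eq_add_of_le hn
  obtain ⟨a, ha, hμ⟩ := A.exists_rows_le_hausdorffMeasure hd hR0 hB0 le_rfl
  set σ : List (Point d) := rows B a R ++ padding (B ^ R) e (a R) with hσ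
  have hnd : σ.Nodup := nodup_rows_append_padding hd ha hR0 hB0 e
  have hlen : σ.length = ∑ l ∈ Finset.range (R + 1), (B ^ l + 1) + e := by
    rw [hσ, List.length_append, length_rows, padding, List.length_map, List.length_range]
  obtain ⟨G, hGw, hG⟩ := exists_isSteinerSpanner_weight_le_two hd hε ha hB (hceil _ _ hRε)
    (hceil _ _ hF) (hceil _ _ hB1) (hceil _ _ hB2) hB3
    -- This grid on the last line contains both the last row and the padding.
    (D := B ^ R * (e + 1)) (by positivity) (Nat.dvd_mul_right _ _)
  have hopt : opt (1 + ε) {s | s ∈ σ} ≤ ENNReal.ofReal 2 := by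
    refine (opt_le_of_isSteinerSpanner hG fun p hp => ?_).trans (ENNReal.ofReal_le_ofReal hGw)
    rcases List.mem_append.1 hp with hp | hp
    · exact Or.inl hp
    · exact Or.inr (mem_row_of_mem_padding (pow_pos hB0 R) hp)
  have hweight : ENNReal.ofReal (R / 4) ≤ ENNReal.ofReal (A.output σ).weight :=
    (hμ.trans (measure_mono (A.carrier_subset_append _ _ hnd))).trans
      (GeomGraph.hausdorffMeasure_carrier_le _)
  calc (M : ℝ≥0∞) = ENNReal.ofReal (2 * M / 2) := by
        rw [mul_div_cancel_left₀ _ (two_ne_zero), ENNReal.ofReal_natCast]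
    _ ≤ ENNReal.ofReal (R / 4 / 2) := by
        have : (8 * M : ℝ) ≤ R := by exact_mod_cast hRM
        exact ENNReal.ofReal_le_ofReal (by linarith)
    _ = ENNReal.ofReal (R / 4) / ENNReal.ofReal 2 := ENNReal.ofReal_div_of_pos two_pos
    _ ≤ ENNReal.ofReal (A.output σ).weight / opt (1 + ε) {s | s ∈ σ} :=
        ENNReal.div_le_div hweight hopt
    _ ≤ A.competitiveRatio _ :=
        le_iSup₂ (f := fun (σ : List (Point d)) (_ : σ.Nodup ∧ σ.length = _) =>
          ENNReal.ofReal (A.output σ).weight / opt (1 + ε) {s | s ∈ σ}) σ ⟨hnd, hlen⟩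

end OnlineSpanner

theorem mainTheorem5 (ε : ℝ) (hε : 0 < ε) (d : ℕ) (hd : 2 ≤ d) :
    ∃ f : ℕ → ℝ, Tendsto f atTop atTop ∧
      ∃ c : ℝ, 0 < c ∧ ∃ n₀ : ℕ,
        ∀ A : OnlineSpanner.OnlineAlgorithm d (1 + ε), ∀ n : ℕ, n₀ ≤ n →
          ENNReal.ofReal (c * f n) ≤ A.competitiveRatio n := by
  classical
  let P : ℕ → ℕ → Prop := fun n M =>
    ∀ A : OnlineSpanner.OnlineAlgorithm d (1 + ε), (M : ℝ≥0∞) ≤ A.competitiveRatio n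
  -- `f n` is the largest `M ≤ n` that bounds the ratio at `n` from below for all algorithms at
  -- once. The cap at `n` keeps it finite and does not prevent divergence; `M = 0` always qualifies.
  refine ⟨fun n => (Nat.findGreatest (P n) n : ℕ), ?_, 1, one_pos, 0, fun A n _ => ?_⟩
  · refine tendsto_natCast_atTop_atTop.comp (tendsto_atTop.2 fun M => ?_)
    obtain ⟨n₀, hn₀⟩ := OnlineSpanner.exists_forall_natCast_le_competitiveRatio hε hd M
    filter_upwards [eventually_ge_atTop (max n₀ M)] with n hn
    exact Nat.le_findGreatest ((le_max_right _ _).trans hn)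
      (hn₀ n ((le_max_left _ _).trans hn))
  · rw [one_mul, ENNReal.ofReal_natCast]
    exact Nat.findGreatest_spec (P := P n) (Nat.zero_le n) (fun A => by simp) A
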